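/- **Theorem.** Let $(\mathcal C,f)$ be a spin modular category: $\mathcal C$ is a unitary modular category over $\mathbb C$ (a unitary ribbon fusion category, with quantum trace $\operatorname{tr}$ satisfying $\operatorname{tr}(g^\dagger g)>0$ for all morphisms $g\neq 0$, whose $S$-matrix is invertible) with braiding $c$ and twist $\theta$, and $f$ is a fermion, i.e. a simple object with $f\otimes f\cong\mathbf 1$ and $\theta_f=-\mathrm{id}_f$. Let $\Pi$ be the finite set of isomorphism classes (labels) of simple objects $X_i$, with $0$ the label of $\mathbf 1$; put $d_i=\dim X_i$, $D=\big(\sum_{i\in\Pi}d_i^2\big)^{1/2}>0$, $s_{ij}=\frac1D\operatorname{tr}(c_{X_j,X_i}\circ c_{X_i,X_j})$ and $N_{ij}^k=\dim_{\mathbb C}\operatorname{Hom}(X_i\otimes X_j,X_k)$. Let $fi$ denote the label of $f\otimes X_i$. A label $i$ is even if $c_{f,X_i}\circ c_{X_i,f}=\mathrm{id}_{X_i\otimes f}$; let $I_0\subseteq\Pi$ be the set of even labels and $[I_0]$ the set of orbits $[i]=\{i,fi\}$ with $i\in I_0$. For $i,j,k\in I_0$ put $$[s]_{[i],[j]}=2s_{ij},\qquad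 N_{[i][j]}^{[k]}=N_{ij}^k+N_{ij}^{fk}.$$ Then $[s]_{[i],[j]}$ and $N_{[i][j]}^{[k]}$ are well defined (they do not depend on the representatives of the orbits), and: 1. The matrix $[s]=([s]_{a,b})_{a,b\in[I_0]}$ is unitary. 2. $[s]_{[0],r}\neq 0$ for all $r\in[I_0]$, and the Verlinde formula holds: for all $a,b,c\in[I_0]$, $$N_{ab}^{c}=\sum_{r\in[I_0]}\frac{[s]_{a,r}\,[s]_{b,r}\,\overline{[s]_{c,r}}}{[s]_{[0],r}}.$$ -/

import Mathlib

open CategoryTheory CategoryTheory.Limits CategoryTheory.MonoidalCategory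

universe v u

namespace SpinModular

noncomputable section

/-! ### Fusion categories -/

/-- The properties that make a `ℂ`-linear abelian rigid monoidal category with bilinear tensor
product a fusion category over `ℂ`.

Rigidity is supplied by `RightRigidCategory`, where `Xᘁ` comes with `η_ X Xᘁ : 𝟙_ C ⟶ X ⊗ Xᘁ` and
`ε_ X Xᘁ : Xᘁ ⊗ X ⟶ 𝟙_ C`; in a braided category duals on one side are also duals on the other. -/
class IsFusion (C : Type u) [Category.{v} C] [Abelian C] [Linear ℂ C] [MonoidalCategory C]
    [MonoidalPreadditive C] [MonoidalLinear ℂ C] [RightRigidCategory C] : Prop where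
  /-- Hom spaces are finite dimensional. -/
  finiteDimensional_hom : ∀ X Y : C, FiniteDimensional ℂ (X ⟶ Y)
  /-- Every object is a finite direct sum of simple objects. -/
  semisimple : ∀ X : C, ∃ (n : ℕ) (S : Fin n → C) (b : Bicone S),
    (∀ a, Simple (S a)) ∧ Nonempty b.IsBilimit ∧ Nonempty (X ≅ b.pt)
  /-- There are finitely many simple objects up to isomorphism. -/
  finite_simples : ∃ (n : ℕ) (S : Fin n → C), ∀ X : C, Simple X → ∃ a, Nonempty (X ≅ S a)
  /-- The tensor unit is simple. -/
  simple_unit : Simple (𝟙_ C)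

/-- Two simple objects are identified when they are isomorphic. -/
instance simpleSetoid (C : Type u) [Category.{v} C] [HasZeroMorphisms C] :
    Setoid {X : C // Simple X} where
  r X Y := Nonempty (X.1 ≅ Y.1)
  iseqv :=
    { refl := fun X => ⟨Iso.refl X.1⟩
      symm := fun ⟨e⟩ => ⟨e.symm⟩
      trans := fun ⟨e⟩ ⟨e'⟩ => ⟨e.trans e'⟩ }

/-- The label set: isomorphism classes of simple objects. -/
def Label (C : Type u) [Category.{v} C] [HasZeroMorphisms C] : Type u :=
  Quotient (simpleSetoid C)

namespace Label

variable {C : Type u} [Category.{v} C] [HasZeroMorphisms C]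

/-- The label of a simple object. -/
def mk (X : C) (hX : Simple X) : Label C := Quotient.mk (simpleSetoid C) ⟨X, hX⟩

/-- A representative simple object of a label. -/
def obj (i : Label C) : C := (Quotient.out i).1

theorem simple_obj (i : Label C) : Simple i.obj := (Quotient.out i).2

theorem mk_obj (i : Label C) : mk i.obj i.simple_obj = i := Quotient.out_eq i

theorem mk_eq_mk {X Y : C} {hX : Simple X} {hY : Simple Y} :
    mk X hX = mk Y hY ↔ Nonempty (X ≅ Y) := Quotient.eq

end Label

section Fusion

variable (C : Type u) [Category.{v} C] [Abelian C] [Linear ℂ C] [MonoidalCategory C]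
  [MonoidalPreadditive C] [MonoidalLinear ℂ C] [RightRigidCategory C] [IsFusion C]

instance finite_label : Finite (Label C) := by
  obtain ⟨n, S, hS⟩ := IsFusion.finite_simples (C := C)
  choose g hg using fun i : Label C => hS i.obj i.simple_obj
  refine Finite.of_injective g fun i j hij => ?_
  obtain ⟨e⟩ := hg i
  obtain ⟨e'⟩ := hg j
  rw [← i.mk_obj, ← j.mk_obj, Label.mk_eq_mk]
  exact ⟨e.trans ((eqToIso (by rw [hij])).trans e'.symm)⟩

instance fintype_label : Fintype (Label C) := Fintype.ofFinite _

instance decidableEq_label : DecidableEq (Label C) := Classical.decEq _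

/-- The label `0` of the tensor unit. -/
def unitLabel : Label C := Label.mk (𝟙_ C) IsFusion.simple_unit

variable {C}

theorem exists_scalar (g : 𝟙_ C ⟶ 𝟙_ C) : ∃ c : ℂ, c • 𝟙 (𝟙_ C) = g := by
  have := IsFusion.simple_unit (C := C)
  have := IsFusion.finiteDimensional_hom (𝟙_ C) (𝟙_ C)
  exact endomorphism_simple_eq_smul_id ℂ g

/-- The complex number `c` with `g = c • 𝟙`, for an endomorphism `g` of the tensor unit. -/
def scalar (g : 𝟙_ C ⟶ 𝟙_ C) : ℂ := Classical.choose (exists_scalar g)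

theorem scalar_smul (g : 𝟙_ C ⟶ 𝟙_ C) : scalar g • 𝟙 (𝟙_ C) = g :=
  Classical.choose_spec (exists_scalar g)

/-- The fusion coefficients `N_{ij}^k = dim Hom(X_i ⊗ X_j, X_k)`. -/
def fusionCoeff (i j k : Label C) : ℕ := Module.finrank ℂ (i.obj ⊗ j.obj ⟶ k.obj)

end Fusion

/-! ### Ribbon structures and the quantum trace -/

/-- A ribbon structure (twist) on a braided rigid category. -/
class Ribbon (C : Type u) [Category.{v} C] [MonoidalCategory C] [BraidedCategory C]
    [RightRigidCategory C] where
  /-- The twist `θ_X`. -/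
  twist : ∀ X : C, X ≅ X
  twist_naturality : ∀ {X Y : C} (g : X ⟶ Y), g ≫ (twist Y).hom = (twist X).hom ≫ g
  /-- `θ_{X ⊗ Y} = c_{Y,X} ∘ c_{X,Y} ∘ (θ_X ⊗ θ_Y)`. -/
  twist_tensor : ∀ X Y : C, (twist (X ⊗ Y)).hom =
    ((twist X).hom ⊗ₘ (twist Y).hom) ≫ (β_ X Y).hom ≫ (β_ Y X).hom
  /-- `θ_{X*} = (θ_X)*`. -/
  twist_dual : ∀ X : C, (twist (Xᘁ)).hom = ((twist X).hom)ᘁ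

section Trace

variable {C : Type u} [Category.{v} C] [Abelian C] [Linear ℂ C] [MonoidalCategory C]
  [MonoidalPreadditive C] [MonoidalLinear ℂ C] [BraidedCategory C] [RightRigidCategory C]
  [IsFusion C] [Ribbon C]

/-- The quantum trace of an endomorphism `g` of `X`: the scalar
`ev_X ∘ c_{X,X*} ∘ ((θ_X ∘ g) ⊗ id) ∘ coev_X`. -/
def qtrace {X : C} (g : X ⟶ X) : ℂ :=
  scalar (η_ X (Xᘁ) ≫ (g ≫ (Ribbon.twist X).hom) ▷ (Xᘁ) ≫ (β_ X (Xᘁ)).hom ≫ ε_ X (Xᘁ))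

/-- The quantum dimension of an object. -/
def qdim (X : C) : ℂ := qtrace (𝟙 X)

variable (C)

/-- The unnormalized `S`-matrix, `s̃_{ij} = tr(c_{X_j,X_i} ∘ c_{X_i,X_j})`. -/
def unnormalizedS : Matrix (Label C) (Label C) ℂ :=
  fun i j => qtrace ((β_ i.obj j.obj).hom ≫ (β_ j.obj i.obj).hom)

/-- `D`, the nonnegative square root of `D² = ∑_i d_i²`
(in a unitary category all the `d_i` are real). -/
def totalDim : ℝ := Real.sqrt (∑ i : Label C, qdim i.obj ^ 2).re

/-- The normalized `S`-matrix `s = s̃ / D`. -/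
def normalizedS : Matrix (Label C) (Label C) ℂ :=
  fun i j => unnormalizedS C i j / (totalDim C : ℂ)

/-- A ribbon fusion category is modular when its `S`-matrix is invertible. -/
def IsModular : Prop := IsUnit (unnormalizedS C).det

/-- A unitary structure on a ribbon fusion category over `ℂ`: a conjugate-linear involutive
contravariant operation `g ↦ g†`, identical on objects, which respects the tensor product, for
which the associators, unitors, braidings and twists are unitary, and such that the quantum trace
is positive, `tr(g† ∘ g) > 0` for every morphism `g ≠ 0`. (The last condition makes `†` a positive
`*`-structure and says that quantum dimensions of nonzero objects are positive.) -/
class Unitary where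
  /-- The adjoint `g†`. -/
  dagger : ∀ {X Y : C}, (X ⟶ Y) → (Y ⟶ X)
  dagger_dagger : ∀ {X Y : C} (g : X ⟶ Y), dagger (dagger g) = g
  dagger_id : ∀ X : C, dagger (𝟙 X) = 𝟙 X
  dagger_comp : ∀ {X Y Z : C} (g : X ⟶ Y) (h : Y ⟶ Z), dagger (g ≫ h) = dagger h ≫ dagger g
  dagger_add : ∀ {X Y : C} (g h : X ⟶ Y), dagger (g + h) = dagger g + dagger h
  dagger_smul : ∀ {X Y : C} (c : ℂ) (g : X ⟶ Y),
    dagger (c • g) = (starRingEnd ℂ c) • dagger g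
  dagger_tensor : ∀ {X Y X' Y' : C} (g : X ⟶ Y) (h : X' ⟶ Y'),
    dagger (g ⊗ₘ h) = dagger g ⊗ₘ dagger h
  dagger_associator : ∀ X Y Z : C, dagger (α_ X Y Z).hom = (α_ X Y Z).inv
  dagger_leftUnitor : ∀ X : C, dagger (λ_ X).hom = (λ_ X).inv
  dagger_rightUnitor : ∀ X : C, dagger (ρ_ X).hom = (ρ_ X).inv
  dagger_braiding : ∀ X Y : C, dagger (β_ X Y).hom = (β_ X Y).inv
  dagger_twist : ∀ X : C, dagger (Ribbon.twist X).hom = (Ribbon.twist X).inv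
  qtrace_pos : ∀ {X Y : C} (g : X ⟶ Y), g ≠ 0 →
    0 < (qtrace (g ≫ dagger g)).re ∧ (qtrace (g ≫ dagger g)).im = 0

end Trace

/-! ### Fermions -/

/-- A fermion: a simple object `f` with `f ⊗ f ≅ 𝟙` and `θ_f = -1`. -/
structure IsFermion {C : Type u} [Category.{v} C] [Preadditive C] [MonoidalCategory C]
    [BraidedCategory C] [RightRigidCategory C] [Ribbon C] (F : C) : Prop where
  simple : Simple F
  tensor_self : Nonempty (F ⊗ F ≅ 𝟙_ C)
  twist_eq : (Ribbon.twist F).hom = -𝟙 F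

section Fermion

variable {C : Type u} [Category.{v} C] [Abelian C] [MonoidalCategory C]
  [BraidedCategory C] [RightRigidCategory C] [Ribbon C] {F : C}

/-- `F ⊗ (F ⊗ X) ≅ X`, naturally in `X`. -/
def cancelIso (e : F ⊗ F ≅ 𝟙_ C) : tensorLeft F ⋙ tensorLeft F ≅ 𝟭 C :=
  NatIso.ofComponents (fun X => (α_ F F X).symm ≪≫ whiskerRightIso e X ≪≫ λ_ X)
    (fun {X Y} g => by
      change F ◁ F ◁ g ≫ (α_ F F Y).inv ≫ e.hom ▷ Y ≫ (λ_ Y).hom =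
        ((α_ F F X).inv ≫ e.hom ▷ X ≫ (λ_ X).hom) ≫ g
      rw [Category.assoc, Category.assoc, ← leftUnitor_naturality, ← whisker_exchange_assoc,
        associator_inv_naturality_right_assoc])

theorem IsFermion.simple_tensor (hF : IsFermion F) {X : C} (hX : Simple X) : Simple (F ⊗ X) := by
  obtain ⟨e⟩ := hF.tensor_self
  let E : C ≌ C := CategoryTheory.Equivalence.mk (tensorLeft F) (tensorLeft F)
    (cancelIso e).symm (cancelIso e)
  have hE : (tensorLeft F).IsEquivalence := inferInstanceAs E.functor.IsEquivalence
  have : Simple ((𝟭 C).obj X) := hX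
  have : Simple ((tensorLeft F).obj (F ⊗ X)) := Simple.of_iso ((cancelIso e).app X)
  exact (tensorLeft F).simple_of_simple_obj (F ⊗ X)

/-- The action `i ↦ f i` of a fermion on labels, induced by `X ↦ f ⊗ X`. -/
def act (hF : IsFermion F) : Label C → Label C :=
  Quotient.map (fun X => ⟨F ⊗ X.1, hF.simple_tensor X.2⟩)
    (fun _ _ ⟨e⟩ => ⟨whiskerLeftIso F e⟩)

theorem act_act (hF : IsFermion F) (i : Label C) : act hF (act hF i) = i := by
  obtain ⟨e⟩ := hF.tensor_self
  induction i using Quotient.inductionOn with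
  | h X => exact Quotient.sound ⟨(cancelIso e).app X.1⟩

/-- The label `i` lies in the trivial (even) sector: `c_{f,i} ∘ c_{i,f} = id`. (For simple `X_i`
this double braiding is a sign `ε_i` times the identity.) -/
def IsEven (F : C) (i : Label C) : Prop :=
  (β_ i.obj F).hom ≫ (β_ F i.obj).hom = 𝟙 (i.obj ⊗ F)

/-- The set `I₀` of even labels. -/
def EvenLabel (F : C) : Type u := {i : Label C // IsEven F i}

/-- The orbit relation of the fermion action on even labels. -/
def orbitSetoid (hF : IsFermion F) : Setoid (EvenLabel F) where
  r i j := j.1 = i.1 ∨ j.1 = act hF i.1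
  iseqv :=
    { refl := fun i => Or.inl rfl
      symm := fun {i j} h => h.imp Eq.symm fun h => by rw [h, act_act]
      trans := fun {i j k} h h' => by
        rcases h with h | h <;> rcases h' with h' | h' <;> rw [h', h]
        · exact Or.inl rfl
        · exact Or.inr rfl
        · exact Or.inr rfl
        · exact Or.inl (act_act hF i.1) }

/-- `[I₀]`, the set of orbits of even labels. -/
def EvenOrbit (hF : IsFermion F) : Type u := Quotient (orbitSetoid hF)

/-- The orbit `[i]` of an even label. -/
def EvenLabel.orbit (hF : IsFermion F) (i : EvenLabel F) : EvenOrbit hF :=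
  Quotient.mk (orbitSetoid hF) i

/-- An even label covering an orbit. -/
def EvenOrbit.rep {hF : IsFermion F} (a : EvenOrbit hF) : Label C := (Quotient.out a).1

instance decidableEq_evenOrbit (hF : IsFermion F) : DecidableEq (EvenOrbit hF) :=
  Classical.decEq _

variable [Linear ℂ C] [MonoidalPreadditive C] [MonoidalLinear ℂ C] [IsFusion C]

instance fintype_evenOrbit (hF : IsFermion F) : Fintype (EvenOrbit hF) :=
  have : Finite (EvenLabel F) := inferInstanceAs (Finite {i : Label C // IsEven F i})
  have : Finite (EvenOrbit hF) := inferInstanceAs (Finite (Quotient (orbitSetoid hF)))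
  Fintype.ofFinite _

theorem isEven_unitLabel (F : C) : IsEven F (unitLabel C) := by
  obtain ⟨e⟩ : Nonempty ((unitLabel C).obj ≅ 𝟙_ C) :=
    Label.mk_eq_mk.1 (Label.mk_obj (unitLabel C))
  have h : (β_ (𝟙_ C) F).hom ≫ (β_ F (𝟙_ C)).hom = 𝟙 (𝟙_ C ⊗ F) := by simp
  unfold IsEven
  rw [← cancel_mono (e.hom ▷ F), Category.assoc, ← BraidedCategory.braiding_naturality_right,
    ← BraidedCategory.braiding_naturality_left_assoc, h, Category.comp_id, Category.id_comp]

/-- The label `0` as an even label. -/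
def evenUnit (F : C) : EvenLabel F := ⟨unitLabel C, isEven_unitLabel F⟩

/-- The matrix `[s]` indexed by `[I₀]`, `[s]_{[i],[j]} = 2 s_{ij}`. -/
def quotientS (hF : IsFermion F) : Matrix (EvenOrbit hF) (EvenOrbit hF) ℂ :=
  fun a b => 2 * normalizedS C a.rep b.rep

/-- The naive fusion rules `N_{[i][j]}^{[k]} = N_{ij}^k + N_{ij}^{fk}`. -/
def naiveFusion (hF : IsFermion F) (a b c : EvenOrbit hF) : ℕ :=
  fusionCoeff a.rep b.rep c.rep + fusionCoeff a.rep b.rep (act hF c.rep)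

end Fermion

end

end SpinModular

/-!
A strand coloured by a simple object `X` sees a loop `Z` linked with it as a scalar. Hence the
Hopf link invariant satisfies `⟨X, Y ⊗ Z⟩ ⟨X, 𝟙⟩ = ⟨X, Y⟩ ⟨X, Z⟩`, and the columns of the
`S`-matrix, divided by their entries at `0`, are characters of the fusion ring:
`N i * S = S * diag χ_i`. Duality gives in the same way that `S * N i` is `S` with rescaled rows.
Evaluating `S * N i * Sᴴ` in two ways shows first, on the diagonal, that the scaling factors are the
conjugates of `χ_i`, and then, off the diagonal, that rows with different characters are
orthogonal; as `S` is invertible, the characters are pairwise different. The Gram matrix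
`S * Sᴴ` commutes with every `N i`, so it is scalar. This is the unitarity of `s`, and the Verlinde
formula for `s` is `N i * S * Sᴴ = S * diag χ_i * Sᴴ`.

A fermion braids with the label `r` by a sign `ε_r`, and `s_{fi,r} = ε_r s_{ir}`. It fixes no
even label, because the twists of `f ⊗ X` and `X` differ by the sign `-1` when `X` is even. A sum
over even orbits is therefore a quarter of the sum over all labels with weights `1 + ε_r`. The
term `1` of this weight reproduces unitarity and the Verlinde formula of `s` at `k`, the term
`ε_r` those at `fk`.
-/

namespace SpinModular

open BraidedCategory ExactPairing
open scoped ComplexConjugate ComplexOrder Matrix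

noncomputable section

/-! ### Monodromy and partial traces -/

section Braided

variable {C : Type u} [Category.{v} C] [MonoidalCategory C] [BraidedCategory C]

/-- The monodromy (double braiding) `c_{Y,X} ∘ c_{X,Y}` of two objects. -/
def monodromy (X Y : C) : X ⊗ Y ⟶ X ⊗ Y := (β_ X Y).hom ≫ (β_ Y X).hom

theorem monodromy_naturality_right (X : C) {Y Z : C} (g : Y ⟶ Z) :
    X ◁ g ≫ monodromy X Z = monodromy X Y ≫ X ◁ g := by
  simp [monodromy]

theorem monodromy_unit_left (X : C) : monodromy (𝟙_ C) X = 𝟙 _ := by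
  simp [monodromy]

theorem monodromy_tensor_right (X Y Z : C) :
    (α_ X Y Z).hom ≫ monodromy X (Y ⊗ Z) ≫ (α_ X Y Z).inv =
      (β_ X Y).hom ▷ Z ≫ (𝟙 _ ⊗≫ Y ◁ monodromy X Z ⊗≫ 𝟙 _ : (Y ⊗ X) ⊗ Z ⟶ (Y ⊗ X) ⊗ Z) ≫
        (β_ Y X).hom ▷ Z := by
  simp only [monodromy, braiding_tensor_left_hom, braiding_tensor_right_hom]
  monoidal

theorem monodromy_whiskerRight_comp_braiding (X Y Z : C) :
    monodromy X Y ▷ Z ≫ (β_ (X ⊗ Y) Z).hom =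
      𝟙 _ ⊗≫ (β_ X (Y ⊗ Z)).hom ⊗≫ (β_ Y (Z ⊗ X)).hom ⊗≫ 𝟙 _ := by
  rw [monodromy, MonoidalCategory.comp_whiskerRight, Category.assoc, braiding_naturality_left]
  simp only [braiding_tensor_left_hom, braiding_tensor_right_hom]
  monoidal

theorem monodromy_whiskerRight_comp_evaluation (X X' Y Y' : C) (e : X' ⊗ X ⟶ 𝟙_ C)
    (e' : Y' ⊗ Y ⟶ 𝟙_ C) :
    monodromy X Y ▷ (Y' ⊗ X') ≫ (β_ (X ⊗ Y) (Y' ⊗ X')).hom ⊗≫ Y' ◁ e ▷ Y ⊗≫ e' =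
      𝟙 _ ⊗≫ X ◁ ((β_ Y Y').hom ≫ e') ▷ X' ⊗≫ (β_ X X').hom ≫ e := by
  calc
    _ = (monodromy X Y ▷ (Y' ⊗ X') ≫ (β_ (X ⊗ Y) (Y' ⊗ X')).hom) ⊗≫ Y' ◁ e ▷ Y ⊗≫ e' := by
      monoidal
    _ = 𝟙 _ ⊗≫ (β_ X (Y ⊗ Y' ⊗ X')).hom ⊗≫ ((β_ Y ((Y' ⊗ X') ⊗ X)).hom ≫
        (𝟙 _ ⊗≫ Y' ◁ e ⊗≫ 𝟙 _ : (Y' ⊗ X') ⊗ X ⟶ Y') ▷ Y) ⊗≫ e' := by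
      rw [monodromy_whiskerRight_comp_braiding]
      monoidal
    _ = 𝟙 _ ⊗≫ (β_ X (Y ⊗ Y' ⊗ X')).hom ⊗≫
        ((Y ⊗ Y') ◁ e ≫ ((β_ Y Y').hom ≫ e') ▷ 𝟙_ C) ⊗≫ 𝟙 _ := by
      rw [← braiding_naturality_right]
      monoidal
    _ = 𝟙 _ ⊗≫ ((β_ X (Y ⊗ Y' ⊗ X')).hom ≫
        (𝟙 _ ⊗≫ ((β_ Y Y').hom ≫ e') ▷ X' ⊗≫ 𝟙 _ : Y ⊗ Y' ⊗ X' ⟶ X') ▷ X) ⊗≫ e := by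
      rw [whisker_exchange]
      monoidal
    _ = _ := by
      rw [← braiding_naturality_right]
      monoidal

end Braided

section Ribbon

variable {C : Type u} [Category.{v} C] [MonoidalCategory C] [BraidedCategory C]
  [RightRigidCategory C] [Ribbon C]

theorem twist_unit : (Ribbon.twist (𝟙_ C)).hom = 𝟙 _ := by
  have h := Ribbon.twist_naturality (λ_ (𝟙_ C)).hom
  rw [Ribbon.twist_tensor] at h
  have h' : (β_ (𝟙_ C) (𝟙_ C)).hom ≫ (β_ (𝟙_ C) (𝟙_ C)).hom = 𝟙 _ := monodromy_unit_left _
  rw [h', Category.comp_id, MonoidalCategory.tensorHom_def, Category.assoc,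
    leftUnitor_naturality, unitors_equal, rightUnitor_naturality_assoc, cancel_epi] at h
  rw [← cancel_epi (Ribbon.twist (𝟙_ C)).hom, ← h, Category.comp_id]

/-- The evaluation `X ⊗ X' ⟶ 𝟙_ C` obtained from the one of an exact pairing of `X` with `X'`, which
goes in the wrong order, by inserting the twist and the braiding. -/
def twistedEvaluation (X X' : C) [ExactPairing X X'] : X ⊗ X' ⟶ 𝟙_ C :=
  (Ribbon.twist X).hom ▷ X' ≫ (β_ X X').hom ≫ ε_ X X'

/-- The ribbon trace of an endomorphism of `X`, as an endomorphism of the tensor unit; any exact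
pairing of `X` with an object `X'` may be used, in place of the one with the chosen dual `Xᘁ`. -/
def ribbonTrace {X : C} (X' : C) [ExactPairing X X'] (g : X ⟶ X) : 𝟙_ C ⟶ 𝟙_ C :=
  η_ X X' ≫ g ▷ X' ≫ twistedEvaluation X X'

theorem ribbonTrace_comp_comm {X Y : C} (X' Y' : C) [ExactPairing X X'] [ExactPairing Y Y']
    (g : X ⟶ Y) (h : Y ⟶ X) : ribbonTrace X' (g ≫ h) = ribbonTrace Y' (h ≫ g) := by
  let _ : HasRightDual X := ⟨X'⟩
  let _ : HasRightDual Y := ⟨Y'⟩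
  obtain ⟨mate, hη, hε⟩ : ∃ mate : X' ⟶ Y', η_ X X' ≫ X ◁ mate = η_ Y Y' ≫ h ▷ Y' ∧
      mate ▷ Y ≫ ε_ Y Y' = X' ◁ h ≫ ε_ X X' :=
    ⟨hᘁ, coevaluation_comp_rightAdjointMate h, rightAdjointMate_comp_evaluation h⟩
  calc
    _ = η_ X X' ≫ (g ≫ h ≫ (Ribbon.twist X).hom) ▷ X' ≫ (β_ X X').hom ≫ ε_ X X' := by
      simp [ribbonTrace, twistedEvaluation]
    _ = η_ X X' ≫ (g ≫ (Ribbon.twist Y).hom) ▷ X' ≫ (β_ Y X').hom ≫ X' ◁ h ≫ ε_ X X' := by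
      rw [Ribbon.twist_naturality]; simp
    _ = η_ X X' ≫ (g ≫ (Ribbon.twist Y).hom) ▷ X' ≫ Y ◁ mate ≫ (β_ Y Y').hom ≫ ε_ Y Y' := by
      rw [← hε, braiding_naturality_right_assoc]
    _ = (η_ X X' ≫ X ◁ mate) ≫ (g ≫ (Ribbon.twist Y).hom) ▷ Y' ≫ (β_ Y Y').hom ≫ ε_ Y Y' := by
      rw [← whisker_exchange_assoc, Category.assoc]
    _ = _ := by
      rw [hη]; simp [ribbonTrace, twistedEvaluation]

theorem ribbonTrace_eq {X : C} (X' X'' : C) [ExactPairing X X'] [ExactPairing X X''] (g : X ⟶ X) :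
    ribbonTrace X' g = ribbonTrace X'' g := by
  simpa using ribbonTrace_comp_comm X' X'' g (𝟙 X)

theorem twistedEvaluation_tensor (X X' Y Y' : C) [ExactPairing X X'] [ExactPairing Y Y'] :
    twistedEvaluation (X ⊗ Y) (Y' ⊗ X') =
      𝟙 _ ⊗≫ X ◁ twistedEvaluation Y Y' ▷ X' ⊗≫ twistedEvaluation X X' := by
  calc
    _ = ((Ribbon.twist X).hom ▷ Y ≫ X ◁ (Ribbon.twist Y).hom) ▷ (Y' ⊗ X') ≫
        (monodromy X Y ▷ (Y' ⊗ X') ≫ (β_ (X ⊗ Y) (Y' ⊗ X')).hom ⊗≫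
        Y' ◁ ε_ X X' ▷ Y ⊗≫ ε_ Y Y') := by
      rw [twistedEvaluation, Ribbon.twist_tensor, tensor_evaluation,
        MonoidalCategory.tensorHom_def, monodromy]
      monoidal
    _ = 𝟙 _ ⊗≫ ((Ribbon.twist X).hom ▷ ((Y ⊗ Y') ⊗ X') ≫ X ◁ (twistedEvaluation Y Y' ▷ X')) ⊗≫
        (β_ X X').hom ≫ ε_ X X' := by
      rw [monodromy_whiskerRight_comp_evaluation, twistedEvaluation]
      monoidal
    _ = _ := by
      rw [← whisker_exchange]
      simp only [twistedEvaluation]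
      monoidal

/-- The partial trace over the second tensor factor, formed with an exact pairing of `Y` with
`Y'`. -/
def partialTrace {X Z Y : C} (Y' : C) [ExactPairing Y Y'] (g : X ⊗ Y ⟶ Z ⊗ Y) : X ⟶ Z :=
  𝟙 _ ⊗≫ X ◁ η_ Y Y' ⊗≫ g ▷ Y' ⊗≫ Z ◁ twistedEvaluation Y Y' ⊗≫ 𝟙 _

theorem ribbonTrace_partialTrace {X Y : C} (X' Y' : C) [ExactPairing X X'] [ExactPairing Y Y']
    (g : X ⊗ Y ⟶ X ⊗ Y) : ribbonTrace X' (partialTrace Y' g) = ribbonTrace (Y' ⊗ X') g := by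
  rw [ribbonTrace, ribbonTrace, twistedEvaluation_tensor, tensor_coevaluation, partialTrace]
  monoidal

theorem partialTrace_comp_whiskerRight {X Z W Y : C} (Y' : C) [ExactPairing Y Y']
    (g : X ⊗ Y ⟶ Z ⊗ Y) (b : Z ⟶ W) :
    partialTrace Y' (g ≫ b ▷ Y) = partialTrace Y' g ≫ b := by
  calc
    _ = 𝟙 _ ⊗≫ X ◁ η_ Y Y' ⊗≫ g ▷ Y' ⊗≫ (b ▷ (Y ⊗ Y') ≫ W ◁ twistedEvaluation Y Y') ⊗≫ 𝟙 _ := by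
      rw [partialTrace]; monoidal
    _ = _ := by rw [← whisker_exchange, partialTrace]; monoidal

theorem partialTrace_whiskerRight_comp {X Z W Y : C} (Y' : C) [ExactPairing Y Y']
    (a : X ⟶ Z) (g : Z ⊗ Y ⟶ W ⊗ Y) :
    partialTrace Y' (a ▷ Y ≫ g) = a ≫ partialTrace Y' g := by
  calc
    _ = 𝟙 _ ⊗≫ (X ◁ η_ Y Y' ≫ a ▷ (Y ⊗ Y')) ⊗≫ g ▷ Y' ⊗≫ W ◁ twistedEvaluation Y Y' ⊗≫ 𝟙 _ := by
      rw [partialTrace]; monoidal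
    _ = _ := by rw [whisker_exchange, partialTrace]; monoidal

theorem partialTrace_whiskerLeft {X Z Y : C} (W Y' : C) [ExactPairing Y Y']
    (g : X ⊗ Y ⟶ Z ⊗ Y) :
    partialTrace Y' (𝟙 _ ⊗≫ W ◁ g ⊗≫ 𝟙 _ : (W ⊗ X) ⊗ Y ⟶ (W ⊗ Z) ⊗ Y) =
      W ◁ partialTrace Y' g := by
  rw [partialTrace, partialTrace]
  monoidal

end Ribbon

/-! ### Semisimplicity and the Hopf link -/

theorem nonempty_obj_mk_iso {C : Type u} [Category.{v} C] [HasZeroMorphisms C] (X : C)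
    (hX : Simple X) : Nonempty ((Label.mk X hX).obj ≅ X) :=
  Label.mk_eq_mk.1 (Label.mk_obj (Label.mk X hX))

section Linear

variable {k : Type*} [Semiring k] {C : Type u} [Category.{v} C] [Preadditive C] [Linear k C]

variable (k) in
theorem finrank_hom_congr {X X' Y Y' : C} (e : X ≅ X') (e' : Y ≅ Y') :
    Module.finrank k (X ⟶ Y) = Module.finrank k (X' ⟶ Y') :=
  (Linear.homCongr k e e').finrank_eq

section Biproduct

variable {J : Type*} [Fintype J] (S : J → C) [HasBiproduct S]

/-- The universal property of a direct sum as a coproduct, as a linear equivalence. -/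
def biproductDescLinearEquiv (Z : C) : (∀ a, S a ⟶ Z) ≃ₗ[k] (⨁ S ⟶ Z) where
  toFun g := biproduct.desc g
  invFun g a := biproduct.ι S a ≫ g
  map_add' g h := by ext; simp
  map_smul' c g := by ext; simp
  left_inv g := by ext; simp
  right_inv g := by ext; simp

/-- The universal property of a direct sum as a product, as a linear equivalence. -/
def biproductLiftLinearEquiv (Z : C) : (∀ a, Z ⟶ S a) ≃ₗ[k] (Z ⟶ ⨁ S) where
  toFun g := biproduct.lift g
  invFun g a := g ≫ biproduct.π S a
  map_add' g h := by ext; simp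
  map_smul' c g := by ext; simp
  left_inv g := by ext; simp
  right_inv g := by ext; simp

end Biproduct

variable [MonoidalCategory C] [MonoidalPreadditive C] [MonoidalLinear k C]

/-- The duality adjunction `tensorLeftHomEquiv` as a linear equivalence. -/
def tensorLeftHomLinearEquiv (X Y Y' Z : C) [ExactPairing Y Y'] :
    (Y' ⊗ X ⟶ Z) ≃ₗ[k] (X ⟶ Y ⊗ Z) where
  __ := tensorLeftHomEquiv X Y Y' Z
  map_add' g h := by simp [tensorLeftHomEquiv]
  map_smul' c g := by simp [tensorLeftHomEquiv]

end Linear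

section Fusion

attribute [local instance] Abelian.hasFiniteBiproducts

variable {C : Type u} [Category.{v} C] [Abelian C] [Linear ℂ C] [MonoidalCategory C]
  [MonoidalPreadditive C] [MonoidalLinear ℂ C] [RightRigidCategory C] [IsFusion C]

instance simple_label_obj (i : Label C) : Simple i.obj := i.simple_obj

instance simple_tensorUnit : Simple (𝟙_ C) := IsFusion.simple_unit

instance finiteDimensional_hom (X Y : C) : FiniteDimensional ℂ (X ⟶ Y) :=
  IsFusion.finiteDimensional_hom X Y

theorem scalar_eq {g : 𝟙_ C ⟶ 𝟙_ C} {c : ℂ} (h : g = c • 𝟙 _) : scalar g = c :=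
  smul_left_injective ℂ (id_nonzero (𝟙_ C)) ((scalar_smul g).trans h)

theorem scalar_add (g h : 𝟙_ C ⟶ 𝟙_ C) : scalar (g + h) = scalar g + scalar h :=
  scalar_eq (by rw [add_smul, scalar_smul, scalar_smul])

theorem scalar_smul_hom (c : ℂ) (g : 𝟙_ C ⟶ 𝟙_ C) : scalar (c • g) = c * scalar g :=
  scalar_eq (by rw [mul_smul, scalar_smul])

theorem exists_eq_smul_id {X : C} [Simple X] (g : X ⟶ X) : ∃ c : ℂ, g = c • 𝟙 X :=
  (endomorphism_simple_eq_smul_id ℂ g).imp fun _ => Eq.symm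

theorem exists_iso_biproduct (X : C) :
    ∃ (n : ℕ) (l : Fin n → Label C), Nonempty (X ≅ ⨁ fun a => (l a).obj) := by
  obtain ⟨n, S, b, hS, ⟨hb⟩, ⟨e⟩⟩ := IsFusion.semisimple X
  exact ⟨n, fun a => Label.mk (S a) (hS a),
    ⟨e ≪≫ biproduct.uniqueUpToIso S hb ≪≫ (biproduct.mapIso fun a =>
      (nonempty_obj_mk_iso (S a) (hS a)).some).symm⟩⟩

theorem finrank_hom_label (i j : Label C) :
    Module.finrank ℂ (i.obj ⟶ j.obj) = if i = j then 1 else 0 := by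
  have h : Nonempty (i.obj ≅ j.obj) ↔ i = j := by
    rw [← Label.mk_eq_mk (hX := i.simple_obj) (hY := j.simple_obj), i.mk_obj, j.mk_obj]
  classical
  rw [finrank_hom_simple_simple]
  exact if_congr h rfl rfl

theorem finrank_biproduct_hom {J : Type*} [Fintype J] (S : J → C) (Y : C) :
    Module.finrank ℂ (⨁ S ⟶ Y) = ∑ a, Module.finrank ℂ (S a ⟶ Y) := by
  rw [← (biproductDescLinearEquiv S Y).finrank_eq, Module.finrank_pi_fintype]

theorem finrank_hom_biproduct {J : Type*} [Fintype J] (X : C) (S : J → C) :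
    Module.finrank ℂ (X ⟶ ⨁ S) = ∑ a, Module.finrank ℂ (X ⟶ S a) := by
  rw [← (biproductLiftLinearEquiv S X).finrank_eq, Module.finrank_pi_fintype]

theorem finrank_hom_comm (X Y : C) :
    Module.finrank ℂ (X ⟶ Y) = Module.finrank ℂ (Y ⟶ X) := by
  obtain ⟨m, k, ⟨e⟩⟩ := exists_iso_biproduct X
  obtain ⟨n, l, ⟨e'⟩⟩ := exists_iso_biproduct Y
  rw [finrank_hom_congr ℂ e e', finrank_hom_congr ℂ e' e]
  simp only [finrank_biproduct_hom, finrank_hom_biproduct, finrank_hom_label]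
  rw [Finset.sum_comm]
  simp only [eq_comm]

theorem finrank_rightDual_tensor_hom (X Y Z : C) :
    Module.finrank ℂ (Xᘁ ⊗ Y ⟶ Z) = Module.finrank ℂ (X ⊗ Z ⟶ Y) := by
  rw [(tensorLeftHomLinearEquiv Y X Xᘁ Z).finrank_eq, finrank_hom_comm]

theorem fusionCoeff_unitLabel_right (i k : Label C) :
    fusionCoeff i (unitLabel C) k = if i = k then 1 else 0 := by
  obtain ⟨e⟩ := nonempty_obj_mk_iso (𝟙_ C) IsFusion.simple_unit
  rw [fusionCoeff, ← finrank_hom_label]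
  exact finrank_hom_congr ℂ (whiskerLeftIso i.obj e ≪≫ ρ_ i.obj) (Iso.refl _)

section Braided

variable [BraidedCategory C] [Ribbon C]

theorem qtrace_eq_scalar_ribbonTrace {X : C} (X' : C) [ExactPairing X X'] (g : X ⟶ X) :
    qtrace g = scalar (ribbonTrace X' g) := by
  rw [ribbonTrace_eq X' Xᘁ]
  simp [qtrace, ribbonTrace, twistedEvaluation]

theorem qtrace_comp_comm {X Y : C} (g : X ⟶ Y) (h : Y ⟶ X) : qtrace (g ≫ h) = qtrace (h ≫ g) := by
  rw [qtrace_eq_scalar_ribbonTrace Xᘁ, qtrace_eq_scalar_ribbonTrace Yᘁ,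
    ribbonTrace_comp_comm Xᘁ Yᘁ]

theorem qtrace_partialTrace {X Y : C} (g : X ⊗ Y ⟶ X ⊗ Y) :
    qtrace (partialTrace Yᘁ g) = qtrace g := by
  rw [qtrace_eq_scalar_ribbonTrace Xᘁ, qtrace_eq_scalar_ribbonTrace (Yᘁ ⊗ Xᘁ),
    ribbonTrace_partialTrace]

variable (C) in
/-- The quantum trace as a linear functional on the endomorphisms of `X`. -/
def qtraceLinear (X : C) : (X ⟶ X) →ₗ[ℂ] ℂ where
  toFun := qtrace
  map_add' g h := by simp [qtrace_eq_scalar_ribbonTrace Xᘁ, ribbonTrace, scalar_add]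
  map_smul' c g := by simp [qtrace_eq_scalar_ribbonTrace Xᘁ, ribbonTrace, scalar_smul_hom]

theorem qtrace_smul {X : C} (c : ℂ) (g : X ⟶ X) : qtrace (c • g) = c * qtrace g :=
  (qtraceLinear C X).map_smul c g

theorem qtrace_sum {X : C} {ι : Type*} (s : Finset ι) (g : ι → (X ⟶ X)) :
    qtrace (∑ a ∈ s, g a) = ∑ a ∈ s, qtrace (g a) :=
  map_sum (qtraceLinear C X) g s

theorem qdim_congr {X Y : C} (e : X ≅ Y) : qdim X = qdim Y := by
  rw [qdim, qdim, ← e.hom_inv_id, qtrace_comp_comm, e.inv_hom_id]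

variable (C) in
theorem qdim_unit : qdim (𝟙_ C) = 1 := by
  rw [qdim, qtrace_eq_scalar_ribbonTrace (𝟙_ C)]
  apply scalar_eq
  have hη : η_ (𝟙_ C) (𝟙_ C) = (ρ_ (𝟙_ C)).inv := rfl
  have hε : ε_ (𝟙_ C) (𝟙_ C) = (ρ_ (𝟙_ C)).hom := rfl
  simp [ribbonTrace, twistedEvaluation, twist_unit, hη, hε, unitors_inv_equal]

/-- The invariant of the Hopf link whose components are coloured by `X` and `Y`: the unnormalized
`S`-matrix, for objects that need not be simple. -/
def hopf (X Y : C) : ℂ := qtrace (monodromy X Y)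

theorem hopf_comm (X Y : C) : hopf X Y = hopf Y X := qtrace_comp_comm _ _

theorem qtrace_monodromy_comp_whiskerLeft (X : C) {Y Z : C} (g : Y ⟶ Z) (h : Z ⟶ Y) :
    qtrace (monodromy X Y ≫ X ◁ (g ≫ h)) = qtrace (monodromy X Z ≫ X ◁ (h ≫ g)) := by
  rw [MonoidalCategory.whiskerLeft_comp, ← Category.assoc, qtrace_comp_comm,
    ← Category.assoc, monodromy_naturality_right, Category.assoc,
    MonoidalCategory.whiskerLeft_comp]

theorem hopf_congr_right (X : C) {Y Z : C} (e : Y ≅ Z) : hopf X Y = hopf X Z := by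
  simpa [hopf] using qtrace_monodromy_comp_whiskerLeft X e.hom e.inv

theorem hopf_unit_right (X : C) : hopf X (𝟙_ C) = qdim X := by
  rw [hopf_comm, hopf, monodromy_unit_left, ← qdim, qdim_congr (λ_ X)]

/-- Removing the loop `Z` from a simple strand `X` leaves a scalar, which is `hopf X Z / qdim X`
irrespective of what else the strand is linked with. -/
theorem hopf_tensor (X Y Z : C) [Simple X] :
    hopf X (Y ⊗ Z) * qdim X = hopf X Y * hopf X Z := by
  obtain ⟨c, hc⟩ := exists_eq_smul_id (partialTrace Zᘁ (monodromy X Z))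
  have hZ : hopf X Z = c * qdim X := by
    rw [hopf, ← qtrace_partialTrace, hc, qtrace_smul, qdim]
  have hYZ : hopf X (Y ⊗ Z) = c * hopf X Y := by
    rw [hopf, ← Category.comp_id (monodromy X (Y ⊗ Z)), ← (α_ X Y Z).inv_hom_id,
      ← Category.assoc, ← qtrace_comp_comm, monodromy_tensor_right, ← qtrace_partialTrace,
      partialTrace_whiskerRight_comp, partialTrace_comp_whiskerRight, partialTrace_whiskerLeft, hc]
    simp [qtrace_smul, hopf, monodromy]
  rw [hYZ, hZ]
  ring

theorem hopf_biproduct (X : C) {J : Type*} [Fintype J] (S : J → C) :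
    hopf X (⨁ S) = ∑ a, hopf X (S a) := by
  have hS : ∑ a, biproduct.π S a ≫ biproduct.ι S a = 𝟙 (⨁ S) :=
    IsBilimit.total (biproduct.isBilimit S)
  calc
    _ = qtrace (monodromy X (⨁ S) ≫ X ◁ ∑ a, biproduct.π S a ≫ biproduct.ι S a) := by
      rw [hS, MonoidalCategory.whiskerLeft_id, Category.comp_id, hopf]
    _ = ∑ a, qtrace (monodromy X (⨁ S) ≫ X ◁ (biproduct.π S a ≫ biproduct.ι S a)) := by
      rw [whiskerLeft_sum, Preadditive.comp_sum, qtrace_sum]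
    _ = _ := by
      simp only [qtrace_monodromy_comp_whiskerLeft, biproduct.ι_π_self,
        MonoidalCategory.whiskerLeft_id, Category.comp_id, hopf]

theorem hopf_eq_sum (X Y : C) :
    hopf X Y = ∑ l : Label C, Module.finrank ℂ (Y ⟶ l.obj) * hopf X l.obj := by
  obtain ⟨n, m, ⟨e⟩⟩ := exists_iso_biproduct Y
  simp only [finrank_hom_congr ℂ e (Iso.refl _), finrank_biproduct_hom, finrank_hom_label,
    Nat.cast_sum, Finset.sum_mul]
  rw [Finset.sum_comm, hopf_congr_right X e, hopf_biproduct]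
  simp

theorem qdim_tensor (X Y : C) : qdim (X ⊗ Y) = qdim X * qdim Y := by
  simpa [hopf_comm (𝟙_ C), hopf_unit_right, qdim_unit C] using hopf_tensor (𝟙_ C) X Y

theorem qdim_pos [Unitary C] {X : C} (hX : ¬IsZero X) : 0 < qdim X := by
  have h := Unitary.qtrace_pos (𝟙 X) fun h => hX ((IsZero.iff_id_eq_zero X).2 h)
  rw [Unitary.dagger_id, Category.comp_id] at h
  exact Complex.pos_iff.2 ⟨h.1, h.2.symm⟩

theorem qdim_ne_zero [Unitary C] (X : C) [Simple X] : qdim X ≠ 0 :=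
  (qdim_pos (Simple.not_isZero X)).ne'

theorem conj_qdim [Unitary C] (X : C) [Simple X] : conj (qdim X) = qdim X :=
  (qdim_pos (Simple.not_isZero X)).le.isSelfAdjoint.star_eq

end Braided

end Fusion

/-! ### The Verlinde formula -/

/-- A matrix `S` whose columns, divided by their entries at `unit`, are characters of the fusion
ring with structure constants `N` and unit `unit`. The conditions on `S` are those satisfied by
the unnormalized `S`-matrix of a unitary modular category; the last one is the character
property for dual labels, stated without naming a duality on `I`. -/
structure FusionPairing (𝕜 I : Type*) [RCLike 𝕜] [Fintype I] [DecidableEq I] where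
  S : Matrix I I 𝕜
  N : I → I → I → ℕ
  unit : I
  isSymm : S.IsSymm
  isUnit : IsUnit S
  unit_ne_zero : ∀ r, S unit r ≠ 0
  star_unit : ∀ r, star (S unit r) = S unit r
  fusion_unit_right : ∀ i k, N i unit k = if i = k then 1 else 0
  mul_eq : ∀ i j r, S i r * S j r = S unit r * ∑ k, N i j k * S k r
  exists_dual : ∀ i, ∃ c : I → 𝕜, ∀ j r, c r * S r j = S unit r * ∑ k, N i k j * S r k

namespace FusionPairing

variable {𝕜 I : Type*} [RCLike 𝕜] [Fintype I] [DecidableEq I] (P : FusionPairing 𝕜 I)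

/-- The matrix of multiplication by the basis element `i` of the fusion ring. -/
def fusionMatrix (i : I) : Matrix I I 𝕜 := .of fun j k => (P.N i j k : 𝕜)

/-- The value at the basis element `i` of the `r`-th character of the fusion ring. -/
def character (i r : I) : 𝕜 := P.S i r / P.S P.unit r

/-- The global dimension, the sum of the squares of the dimensions `S unit r`. -/
def globalDim : 𝕜 := ∑ r, P.S P.unit r ^ 2

theorem fusionMatrix_mul_S (i : I) :
    P.fusionMatrix i * P.S = P.S * Matrix.diagonal (P.character i) := by
  ext j r
  rw [Matrix.mul_diagonal, character, mul_div_assoc', mul_comm, P.mul_eq,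
    mul_div_cancel_left₀ _ (P.unit_ne_zero r)]
  rfl

theorem map_conj_S : P.S.map (starRingEnd 𝕜) = P.Sᴴ := by
  conv_lhs => rw [← P.isSymm.eq]
  rfl

theorem map_conj_fusionMatrix (i : I) :
    (P.fusionMatrix i).map (starRingEnd 𝕜) = P.fusionMatrix i := by
  ext j k
  simp [fusionMatrix]

theorem fusionMatrix_mul_conjTranspose_S (i : I) :
    P.fusionMatrix i * P.Sᴴ = P.Sᴴ * Matrix.diagonal (star (P.character i)) := by
  have h := congrArg (Matrix.map · (starRingEnd 𝕜)) (P.fusionMatrix_mul_S i)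
  simp only [Matrix.map_mul, map_conj_S, map_conj_fusionMatrix, map_zero, Matrix.diagonal_map] at h
  exact h

theorem gram_self_ne_zero (r : I) : (P.S * P.Sᴴ) r r ≠ 0 := fun h =>
  P.unit_ne_zero r (by
    rw [← P.isSymm.apply]
    exact congrFun (dotProduct_self_star_eq_zero.1 h) P.unit)

-- The dual characters are the conjugate ones: compare the diagonals of `S * N i * Sᴴ`.
theorem S_mul_fusionMatrix (i : I) :
    P.S * P.fusionMatrix i = Matrix.diagonal (star (P.character i)) * P.S := by
  obtain ⟨c, hc⟩ := P.exists_dual i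
  have hSN : P.S * P.fusionMatrix i = Matrix.diagonal (fun r => c r / P.S P.unit r) * P.S := by
    ext r j
    rw [Matrix.diagonal_mul, div_mul_eq_mul_div, hc, mul_div_cancel_left₀ _ (P.unit_ne_zero r)]
    exact Finset.sum_congr rfl fun k _ => mul_comm _ _
  have hgram : Matrix.diagonal (fun r => c r / P.S P.unit r) * (P.S * P.Sᴴ) =
      P.S * P.Sᴴ * Matrix.diagonal (star (P.character i)) := by
    rw [← Matrix.mul_assoc, ← hSN, Matrix.mul_assoc, P.fusionMatrix_mul_conjTranspose_S,
      Matrix.mul_assoc]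
  have hcharacter : (fun r => c r / P.S P.unit r) = star (P.character i) := by
    ext r
    have h := congrFun (congrFun hgram r) r
    rw [Matrix.diagonal_mul, Matrix.mul_diagonal, mul_comm] at h
    exact mul_left_cancel₀ (P.gram_self_ne_zero r) h
  rw [hSN, hcharacter]

theorem conjTranspose_S_mul_fusionMatrix (i : I) :
    P.Sᴴ * P.fusionMatrix i = Matrix.diagonal (P.character i) * P.Sᴴ := by
  have h := congrArg (Matrix.map · (starRingEnd 𝕜)) (P.S_mul_fusionMatrix i)
  simp only [Matrix.map_mul, map_conj_S, map_conj_fusionMatrix, map_zero, Matrix.diagonal_map] at h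
  rw [h]
  congr
  exact funext fun r => star_star _

theorem fusionMatrix_mul_gram (i : I) :
    P.fusionMatrix i * (P.S * P.Sᴴ) = P.S * P.Sᴴ * P.fusionMatrix i := by
  rw [← Matrix.mul_assoc, P.fusionMatrix_mul_S, Matrix.mul_assoc, Matrix.mul_assoc,
    P.conjTranspose_S_mul_fusionMatrix]

theorem gram_mul_star_character (i q r : I) :
    (P.S * P.Sᴴ) q r * star (P.character i r) = (P.S * P.Sᴴ) q r * star (P.character i q) := by
  have h : Matrix.diagonal (star (P.character i)) * (P.S * P.Sᴴ) =
      P.S * P.Sᴴ * Matrix.diagonal (star (P.character i)) := by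
    rw [← Matrix.mul_assoc, ← P.S_mul_fusionMatrix, Matrix.mul_assoc,
      P.fusionMatrix_mul_conjTranspose_S, Matrix.mul_assoc]
  have hqr := congrFun (congrFun h q) r
  rw [Matrix.diagonal_mul, Matrix.mul_diagonal] at hqr
  exact hqr.symm.trans (mul_comm _ _)

theorem eq_of_forall_character_eq {q r : I} (h : ∀ i, P.character i q = P.character i r) :
    q = r := by
  have hrows : LinearIndependent 𝕜 P.S.row := Matrix.linearIndependent_rows_iff_isUnit.2 P.isUnit
  refine hrows.eq_of_smul_apply_eq_smul_apply _ (P.S P.unit q) q r (P.unit_ne_zero r)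
    (funext fun i => ?_)
  have hi := (div_eq_div_iff (P.unit_ne_zero q) (P.unit_ne_zero r)).1 (h i)
  rw [← P.isSymm.apply i q, ← P.isSymm.apply i r] at hi
  simpa only [Pi.smul_apply, smul_eq_mul, Matrix.row, mul_comm] using hi

theorem gram_eq_zero {q r : I} (h : q ≠ r) : (P.S * P.Sᴴ) q r = 0 := by
  contrapose! h
  exact (P.eq_of_forall_character_eq fun i =>
    star_injective (mul_left_cancel₀ h (P.gram_mul_star_character i q r))).symm

theorem gram_unit : (P.S * P.Sᴴ) P.unit P.unit = P.globalDim := by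
  simp only [Matrix.mul_apply, Matrix.conjTranspose_apply, P.star_unit, globalDim, sq]

-- The row `i` of the Gram matrix is its row `unit` multiplied by `N i`.
theorem S_mul_conjTranspose : P.S * P.Sᴴ = P.globalDim • (1 : Matrix I I 𝕜) := by
  ext i k
  have h : (P.fusionMatrix i * (P.S * P.Sᴴ)) P.unit k =
      (P.S * P.Sᴴ * P.fusionMatrix i) P.unit k := by
    rw [P.fusionMatrix_mul_gram]
  calc
    _ = ∑ j, P.fusionMatrix i P.unit j * (P.S * P.Sᴴ) j k := by
      simp [fusionMatrix, P.fusion_unit_right]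
    _ = ∑ j, (P.S * P.Sᴴ) P.unit j * P.fusionMatrix i j k := h
    _ = P.globalDim * P.fusionMatrix i P.unit k := by
      rw [Finset.sum_eq_single P.unit (fun j _ hj => by rw [P.gram_eq_zero hj.symm, zero_mul])
        (by simp), gram_unit]
    _ = _ := by
      simp [fusionMatrix, P.fusion_unit_right, Matrix.one_apply]

theorem globalDim_ne_zero : P.globalDim ≠ 0 :=
  P.gram_unit ▸ P.gram_self_ne_zero P.unit

theorem S_mul_diagonal_character_mul_conjTranspose (i : I) :
    P.S * Matrix.diagonal (P.character i) * P.Sᴴ = P.globalDim • P.fusionMatrix i := by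
  rw [← P.fusionMatrix_mul_S, Matrix.mul_assoc, P.S_mul_conjTranspose, Matrix.mul_smul,
    Matrix.mul_one]

end FusionPairing

section Modular

variable {C : Type u} [Category.{v} C] [Abelian C] [Linear ℂ C] [MonoidalCategory C]
  [MonoidalPreadditive C] [MonoidalLinear ℂ C] [BraidedCategory C] [RightRigidCategory C]
  [IsFusion C] [Ribbon C]

theorem unnormalizedS_unitLabel_left (r : Label C) :
    unnormalizedS C (unitLabel C) r = qdim r.obj := by
  obtain ⟨e⟩ := nonempty_obj_mk_iso (𝟙_ C) IsFusion.simple_unit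
  rw [← hopf_unit_right, ← hopf_congr_right r.obj e]
  exact hopf_comm _ _

theorem normalizedS_comm (i j : Label C) : normalizedS C i j = normalizedS C j i :=
  congrArg (· / (totalDim C : ℂ)) (hopf_comm _ _)

variable [Unitary C]

/-- The pairing of the simple objects of a unitary modular category given by the Hopf link. -/
def fusionPairing (hC : IsModular C) : FusionPairing ℂ (Label C) where
  S := unnormalizedS C
  N := fusionCoeff
  unit := unitLabel C
  isSymm := Matrix.ext fun i j => hopf_comm j.obj i.obj
  isUnit := (Matrix.isUnit_iff_isUnit_det _).2 hC
  unit_ne_zero r := by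
    rw [unnormalizedS_unitLabel_left]
    exact qdim_ne_zero r.obj
  star_unit r := by
    rw [unnormalizedS_unitLabel_left]
    exact conj_qdim r.obj
  fusion_unit_right := fusionCoeff_unitLabel_right
  mul_eq i j r := by
    have h := hopf_tensor r.obj i.obj j.obj
    rw [hopf_eq_sum, mul_comm] at h
    rw [unnormalizedS_unitLabel_left]
    simp only [hopf_comm r.obj] at h
    exact h.symm
  exists_dual i := by
    refine ⟨fun r => hopf r.obj i.objᘁ, fun j r => ?_⟩
    have h := hopf_tensor r.obj i.objᘁ j.obj
    rw [hopf_eq_sum, mul_comm] at h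
    simp only [finrank_rightDual_tensor_hom] at h
    rw [unnormalizedS_unitLabel_left]
    exact h.symm

variable (C) in
theorem totalDim_mul_self : (totalDim C : ℂ) * totalDim C = ∑ i : Label C, qdim i.obj ^ 2 := by
  have h (i : Label C) : qdim i.obj ^ 2 = (((qdim i.obj).re ^ 2 : ℝ) : ℂ) := by
    rw [Complex.ofReal_pow, Complex.conj_eq_iff_re.1 (conj_qdim i.obj)]
  simp_rw [totalDim, h]
  rw [← Complex.ofReal_sum, Complex.ofReal_re, ← Complex.ofReal_mul,
    Real.mul_self_sqrt (Finset.sum_nonneg fun i _ => sq_nonneg _)]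

theorem globalDim_fusionPairing (hC : IsModular C) :
    (fusionPairing hC).globalDim = (totalDim C : ℂ) * totalDim C := by
  rw [totalDim_mul_self]
  exact Finset.sum_congr rfl fun r _ => by rw [← unnormalizedS_unitLabel_left]; rfl

theorem totalDim_ne_zero (hC : IsModular C) : (totalDim C : ℂ) ≠ 0 := fun h =>
  (fusionPairing hC).globalDim_ne_zero (by rw [globalDim_fusionPairing, h, zero_mul])

theorem normalizedS_unitLabel_ne_zero (hC : IsModular C) (r : Label C) :
    normalizedS C (unitLabel C) r ≠ 0 :=
  div_ne_zero ((fusionPairing hC).unit_ne_zero r) (totalDim_ne_zero hC)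

theorem sum_normalizedS_mul_conj (hC : IsModular C) (i k : Label C) :
    ∑ r, normalizedS C i r * conj (normalizedS C k r) = if i = k then 1 else 0 := by
  have hD := totalDim_ne_zero hC
  have h : ∑ r, unnormalizedS C i r * conj (unnormalizedS C k r) =
      totalDim C * totalDim C * if i = k then 1 else 0 := by
    rw [← globalDim_fusionPairing hC, ← Matrix.one_apply]
    exact congrFun (congrFun (fusionPairing hC).S_mul_conjTranspose i) k
  simp only [normalizedS, map_div₀, Complex.conj_ofReal, div_mul_div_comm, ← Finset.sum_div]
  rw [h, mul_div_cancel_left₀ _ (mul_ne_zero hD hD)]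

theorem fusionCoeff_eq_sum (hC : IsModular C) (i j k : Label C) :
    (fusionCoeff i j k : ℂ) = ∑ r, normalizedS C i r * normalizedS C j r *
      conj (normalizedS C k r) / normalizedS C (unitLabel C) r := by
  have hD := totalDim_ne_zero hC
  have h : ∑ r, unnormalizedS C j r * (unnormalizedS C i r / unnormalizedS C (unitLabel C) r) *
      conj (unnormalizedS C k r) = totalDim C * totalDim C * fusionCoeff i j k := by
    rw [← globalDim_fusionPairing hC]
    refine .trans ?_ (congrFun (congrFun
      ((fusionPairing hC).S_mul_diagonal_character_mul_conjTranspose i) j) k)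
    simp only [Matrix.mul_apply (M := _ * _), Matrix.mul_diagonal]
    rfl
  rw [← mul_right_inj' (mul_ne_zero hD hD), ← h, Finset.mul_sum]
  refine Finset.sum_congr rfl fun r _ => ?_
  simp only [normalizedS, map_div₀, Complex.conj_ofReal]
  field_simp

end Modular

/-! ### The action of a fermion -/

section Preadditive

variable {C : Type u} [Category.{v} C] [Preadditive C] [MonoidalCategory C] [MonoidalPreadditive C]

theorem neg_whiskerRight {X Y : C} (g : X ⟶ Y) (Z : C) : (-g) ▷ Z = -(g ▷ Z) :=
  (tensorRight Z).map_neg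

theorem whiskerLeft_neg (X : C) {Y Z : C} (g : Y ⟶ Z) : X ◁ (-g) = -(X ◁ g) :=
  (tensorLeft X).map_neg

end Preadditive

section Orbits

variable {C : Type u} [Category.{v} C] [Abelian C] [MonoidalCategory C] [BraidedCategory C]
  [RightRigidCategory C] [Ribbon C] {F : C}

theorem nonempty_obj_act_iso (hF : IsFermion F) (i : Label C) :
    Nonempty ((act hF i).obj ≅ F ⊗ i.obj) := by
  have h : act hF i = Label.mk (F ⊗ i.obj) (hF.simple_tensor i.simple_obj) := by
    conv_lhs => rw [← i.mk_obj]
    rfl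
  exact h ▸ nonempty_obj_mk_iso _ _

/-- The covering label `a.rep` of an orbit `a`, as an even label. -/
def EvenOrbit.evenRep {hF : IsFermion F} (a : EvenOrbit hF) : EvenLabel F := Quotient.out a

theorem EvenOrbit.isEven_rep {hF : IsFermion F} (a : EvenOrbit hF) : IsEven F a.rep :=
  a.evenRep.2

theorem EvenOrbit.orbit_evenRep {hF : IsFermion F} (a : EvenOrbit hF) : a.evenRep.orbit hF = a :=
  Quotient.out_eq a

theorem EvenLabel.orbit_eq_iff {hF : IsFermion F} {i : EvenLabel F} {a : EvenOrbit hF} :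
    i.orbit hF = a ↔ i.1 = a.rep ∨ i.1 = act hF a.rep := by
  rw [eq_comm, ← a.orbit_evenRep.congr_left]
  exact Quotient.eq

theorem EvenOrbit.rep_inj {hF : IsFermion F} {a b : EvenOrbit hF} : a.rep = b.rep ↔ a = b := by
  refine ⟨fun h => ?_, congrArg _⟩
  rw [← a.orbit_evenRep, EvenLabel.orbit_eq_iff]
  exact Or.inl h

theorem EvenLabel.rep_orbit (hF : IsFermion F) (i : EvenLabel F) :
    (i.orbit hF).rep = i.1 ∨ (i.orbit hF).rep = act hF i.1 :=
  (orbit_eq_iff.1 rfl).imp Eq.symm fun h => by rw [h, act_act]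

theorem IsFermion.isEquivalence_tensorLeft (hF : IsFermion F) : (tensorLeft F).IsEquivalence := by
  obtain ⟨e⟩ := hF.tensor_self
  exact (CategoryTheory.Equivalence.mk (tensorLeft F) (tensorLeft F) (cancelIso e).symm
    (cancelIso e)).isEquivalence_functor

variable [MonoidalPreadditive C]

theorem IsFermion.monodromy_self (hF : IsFermion F) : monodromy F F = 𝟙 (F ⊗ F) := by
  obtain ⟨e⟩ := hF.tensor_self
  have h := Ribbon.twist_naturality e.hom
  rw [twist_unit, Category.comp_id, Ribbon.twist_tensor, hF.twist_eq] at h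
  rw [← cancel_mono e.hom, Category.id_comp, monodromy]
  conv_rhs => rw [h]
  simp [MonoidalCategory.tensorHom_def, neg_whiskerRight, whiskerLeft_neg]

end Orbits

section FusionCoeff

variable {C : Type u} [Category.{v} C] [Abelian C] [Linear ℂ C] [MonoidalCategory C]
  [BraidedCategory C]

theorem fusionCoeff_comm (i j k : Label C) : fusionCoeff i j k = fusionCoeff j i k :=
  finrank_hom_congr ℂ (β_ i.obj j.obj) (Iso.refl _)

variable [MonoidalPreadditive C] [MonoidalLinear ℂ C] [RightRigidCategory C] [Ribbon C] {F : C}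

theorem IsFermion.finrank_tensor_hom (hF : IsFermion F) (X Y : C) :
    Module.finrank ℂ (F ⊗ X ⟶ Y) = Module.finrank ℂ (X ⟶ F ⊗ Y) := by
  obtain ⟨e⟩ := hF.tensor_self
  have := hF.isEquivalence_tensorLeft
  let tensorF : (X ⟶ F ⊗ Y) ≃ₗ[ℂ] (F ⊗ X ⟶ F ⊗ F ⊗ Y) :=
    .ofBijective ((tensorLeft F).mapLinearMap ℂ)
      ⟨(tensorLeft F).map_injective, (tensorLeft F).map_surjective⟩
  rw [tensorF.finrank_eq]
  exact finrank_hom_congr ℂ (Iso.refl _) ((cancelIso e).app Y).symm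

theorem fusionCoeff_act_left (hF : IsFermion F) (i j k : Label C) :
    fusionCoeff (act hF i) j k = fusionCoeff i j (act hF k) := by
  obtain ⟨e⟩ := nonempty_obj_act_iso hF i
  obtain ⟨e'⟩ := nonempty_obj_act_iso hF k
  rw [fusionCoeff, fusionCoeff, finrank_hom_congr ℂ (whiskerRightIso e _ ≪≫ α_ F _ _) (Iso.refl _),
    hF.finrank_tensor_hom, finrank_hom_congr ℂ (Iso.refl _) e'.symm]

theorem fusionCoeff_act_middle (hF : IsFermion F) (i j k : Label C) :
    fusionCoeff i (act hF j) k = fusionCoeff i j (act hF k) := by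
  rw [fusionCoeff_comm, fusionCoeff_act_left, fusionCoeff_comm]

theorem naiveFusion_orbit (hF : IsFermion F) (i j k : EvenLabel F) :
    naiveFusion hF (i.orbit hF) (j.orbit hF) (k.orbit hF) =
      fusionCoeff i.1 j.1 k.1 + fusionCoeff i.1 j.1 (act hF k.1) := by
  rcases i.rep_orbit hF with hi | hi <;> rcases j.rep_orbit hF with hj | hj <;>
    rcases k.rep_orbit hF with hk | hk <;>
    simp only [naiveFusion, hi, hj, hk, fusionCoeff_act_left, fusionCoeff_act_middle, act_act,
      add_comm]

end FusionCoeff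

section Fermion

variable {C : Type u} [Category.{v} C] [Abelian C] [Linear ℂ C] [MonoidalCategory C]
  [MonoidalPreadditive C] [MonoidalLinear ℂ C] [BraidedCategory C] [RightRigidCategory C]
  [IsFusion C] [Ribbon C] {F : C}

-- On a fixed simple object, the twist would equal its own negative.
theorem act_ne_self (hF : IsFermion F) {i : Label C} (hi : IsEven F i) : act hF i ≠ i := by
  intro h
  obtain ⟨e⟩ := nonempty_obj_act_iso hF i
  rw [h] at e
  obtain ⟨t, ht⟩ := exists_eq_smul_id (Ribbon.twist i.obj).hom
  have hβ : (β_ F i.obj).hom ≫ (β_ i.obj F).hom = 𝟙 _ := by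
    rw [← cancel_epi (β_ i.obj F).hom, reassoc_of% hi, Category.comp_id]
  have hneg : -(t • e.hom) = t • e.hom := by
    have h := Ribbon.twist_naturality e.hom
    rw [Ribbon.twist_tensor, hβ, Category.comp_id, hF.twist_eq, ht] at h
    simpa [MonoidalCategory.tensorHom_def, neg_whiskerRight] using h
  have htwist : (Ribbon.twist i.obj).hom = 0 := by
    have : IsAddTorsionFree (i.obj ⟶ F ⊗ i.obj) := .of_isTorsionFree ℂ _
    have he : t • e.hom = 0 := self_eq_neg.1 hneg.symm
    rw [ht, ← e.hom_inv_id, ← Linear.smul_comp, he, zero_comp]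
  exact id_nonzero i.obj (by rw [← (Ribbon.twist i.obj).hom_inv_id, htwist, zero_comp])

theorem EvenOrbit.act_rep_ne {hF : IsFermion F} (a b : EvenOrbit hF) : act hF a.rep ≠ b.rep := by
  intro h
  have hba : b = a := by
    rw [← b.orbit_evenRep, EvenLabel.orbit_eq_iff]
    exact Or.inr h.symm
  exact act_ne_self hF a.isEven_rep (hba ▸ h)

variable (F) in
/-- The scalar by which the monodromy with `F` acts on the simple object `i`, when `F` is a fermion
in a unitary category: it is `1` for even labels and `-1` for the others. -/
def charge (i : Label C) : ℂ := hopf i.obj F / qdim i.obj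

variable [Unitary C]

theorem IsFermion.qdim_eq_one (hF : IsFermion F) : qdim F = 1 := by
  obtain ⟨e⟩ := hF.tensor_self
  have := hF.simple
  have hpos : 0 < qdim F := qdim_pos (Simple.not_isZero F)
  have hsq : qdim F * qdim F = 1 := by rw [← qdim_tensor, qdim_congr e, qdim_unit]
  refine (mul_self_eq_one_iff.1 hsq).resolve_right fun h => ?_
  rw [h] at hpos
  exact absurd hpos (by norm_num [Complex.pos_iff])

theorem qdim_act (hF : IsFermion F) (i : Label C) : qdim (act hF i).obj = qdim i.obj := by
  obtain ⟨e⟩ := nonempty_obj_act_iso hF i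
  rw [qdim_congr e, qdim_tensor, hF.qdim_eq_one, one_mul]

theorem charge_mul_self (hF : IsFermion F) (i : Label C) : charge F i * charge F i = 1 := by
  obtain ⟨e⟩ := hF.tensor_self
  have hd := qdim_ne_zero i.obj
  rw [charge, div_mul_div_comm, ← hopf_tensor, hopf_congr_right _ e, hopf_unit_right,
    div_self (mul_ne_zero hd hd)]

theorem conj_charge (hF : IsFermion F) (i : Label C) : conj (charge F i) = charge F i := by
  rcases mul_self_eq_one_iff.1 (charge_mul_self hF i) with h | h <;> simp [h]

theorem isEven_iff_charge_eq_one (hF : IsFermion F) {i : Label C} :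
    IsEven F i ↔ charge F i = 1 := by
  have : Simple (F ⊗ i.obj) := hF.simple_tensor i.simple_obj
  have : Simple (i.obj ⊗ F) := Simple.of_iso (β_ i.obj F)
  obtain ⟨c, hc⟩ := exists_eq_smul_id (monodromy i.obj F)
  have hcharge : charge F i = c := by
    rw [charge, div_eq_iff (qdim_ne_zero i.obj), hopf, hc, qtrace_smul, ← qdim, qdim_tensor,
      hF.qdim_eq_one, mul_one]
  change monodromy i.obj F = 𝟙 _ ↔ _
  rw [hcharge, hc]
  refine ⟨fun h => smul_left_injective ℂ (id_nonzero (i.obj ⊗ F)) ?_, fun h => ?_⟩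
  · simpa using h
  · rw [h, one_smul]

theorem charge_of_not_isEven (hF : IsFermion F) {i : Label C} (hi : ¬IsEven F i) :
    charge F i = -1 :=
  (mul_self_eq_one_iff.1 (charge_mul_self hF i)).resolve_left
    (mt (isEven_iff_charge_eq_one hF).2 hi)

theorem charge_act (hF : IsFermion F) (i : Label C) : charge F (act hF i) = charge F i := by
  obtain ⟨e⟩ := nonempty_obj_act_iso hF i
  have := hF.simple
  have hFF : hopf F F = 1 := by
    rw [hopf, hF.monodromy_self, ← qdim, qdim_tensor, hF.qdim_eq_one, one_mul]
  have h := hopf_tensor F F i.obj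
  rw [hF.qdim_eq_one, mul_one, hFF, one_mul] at h
  rw [charge, charge, qdim_act, hopf_comm, hopf_congr_right _ e, h, hopf_comm]

theorem isEven_act (hF : IsFermion F) {i : Label C} (hi : IsEven F i) : IsEven F (act hF i) := by
  rwa [isEven_iff_charge_eq_one hF, charge_act, ← isEven_iff_charge_eq_one hF]

theorem normalizedS_act_right (hF : IsFermion F) (i j : Label C) :
    normalizedS C i (act hF j) = charge F i * normalizedS C i j := by
  obtain ⟨e⟩ := nonempty_obj_act_iso hF j
  have h : hopf i.obj (act hF j).obj = charge F i * hopf i.obj j.obj := by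
    rw [hopf_congr_right _ e, charge, div_mul_eq_mul_div, eq_div_iff (qdim_ne_zero i.obj),
      hopf_tensor]
  exact (congrArg (· / (totalDim C : ℂ)) h).trans (mul_div_assoc _ _ _)

theorem normalizedS_act_left (hF : IsFermion F) (i j : Label C) :
    normalizedS C (act hF i) j = charge F j * normalizedS C i j := by
  rw [normalizedS_comm, normalizedS_act_right hF, normalizedS_comm]

theorem normalizedS_act_right_of_isEven (hF : IsFermion F) {i : Label C} (hi : IsEven F i)
    (j : Label C) : normalizedS C i (act hF j) = normalizedS C i j := by
  rw [normalizedS_act_right, (isEven_iff_charge_eq_one hF).1 hi, one_mul]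

theorem normalizedS_act_left_of_isEven (hF : IsFermion F) (i : Label C) {j : Label C}
    (hj : IsEven F j) : normalizedS C (act hF i) j = normalizedS C i j := by
  rw [normalizedS_act_left, (isEven_iff_charge_eq_one hF).1 hj, one_mul]

end Fermion

section Quotient

variable {C : Type u} [Category.{v} C] [Abelian C] [Linear ℂ C] [MonoidalCategory C]
  [MonoidalPreadditive C] [MonoidalLinear ℂ C] [BraidedCategory C] [RightRigidCategory C]
  [IsFusion C] [Ribbon C] [Unitary C] {F : C}

instance fintype_evenLabel (F : C) : Fintype (EvenLabel F) :=
  have : Finite (EvenLabel F) := inferInstanceAs (Finite {i : Label C // IsEven F i})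
  Fintype.ofFinite _

/-- The action of a fermion on even labels. -/
def EvenLabel.act (hF : IsFermion F) (i : EvenLabel F) : EvenLabel F :=
  ⟨SpinModular.act hF i.1, isEven_act hF i.2⟩

instance decidableEq_evenLabel (F : C) : DecidableEq (EvenLabel F) := Classical.decEq _

theorem EvenOrbit.filter_orbit_eq {hF : IsFermion F} (a : EvenOrbit hF) :
    ({i | i.orbit hF = a} : Finset (EvenLabel F)) =
      {a.evenRep, a.evenRep.act hF} := by
  ext i
  simp only [Finset.mem_filter, Finset.mem_univ, true_and, Finset.mem_insert,
    Finset.mem_singleton, EvenLabel.orbit_eq_iff]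
  have hval (j : EvenLabel F) : i.1 = j.1 ↔ i = j := Subtype.ext_iff.symm
  exact or_congr (hval a.evenRep) (hval (a.evenRep.act hF))

theorem EvenOrbit.evenRep_ne_act {hF : IsFermion F} (a : EvenOrbit hF) :
    a.evenRep ≠ a.evenRep.act hF := fun h =>
  act_ne_self hF a.isEven_rep (congrArg Subtype.val h).symm

theorem sum_evenLabel_eq_sum_evenOrbit (hF : IsFermion F) {g : Label C → ℂ}
    (hg : ∀ i, g (act hF i) = g i) :
    ∑ i : EvenLabel F, g i.1 = 2 * ∑ a : EvenOrbit hF, g a.rep := by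
  rw [← Finset.sum_fiberwise Finset.univ (EvenLabel.orbit hF), Finset.mul_sum]
  refine Finset.sum_congr rfl fun a _ => ?_
  rw [a.filter_orbit_eq, Finset.sum_pair a.evenRep_ne_act, two_mul]
  exact congrArg (g a.rep + ·) (hg a.rep)

theorem sum_label_eq_sum_evenLabel (hF : IsFermion F) (g : Label C → ℂ) :
    ∑ i, (1 + charge F i) * g i = 2 * ∑ i : EvenLabel F, g i.1 := by
  classical
  have h (i : Label C) : (1 + charge F i) * g i = if IsEven F i then 2 * g i else 0 := by
    split_ifs with hi
    · rw [(isEven_iff_charge_eq_one hF).1 hi, one_add_one_eq_two]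
    · rw [charge_of_not_isEven hF hi, add_neg_cancel, zero_mul]
  rw [Finset.sum_congr rfl fun i _ => h i, ← Finset.sum_filter, Finset.mul_sum]
  exact Finset.sum_subtype _ (by simp) _

theorem four_mul_sum_evenOrbit (hF : IsFermion F) {g : Label C → ℂ}
    (hg : ∀ i, g (act hF i) = g i) :
    4 * ∑ a : EvenOrbit hF, g a.rep = ∑ i, g i + ∑ i, charge F i * g i := by
  rw [← Finset.sum_add_distrib]
  simp only [← one_add_mul]
  rw [sum_label_eq_sum_evenLabel hF, sum_evenLabel_eq_sum_evenOrbit hF hg]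
  ring

theorem quotientS_orbit (hF : IsFermion F) (i j : EvenLabel F) :
    quotientS hF (i.orbit hF) (j.orbit hF) = 2 * normalizedS C i.1 j.1 := by
  have hi : normalizedS C (i.orbit hF).rep (j.orbit hF).rep =
      normalizedS C i.1 (j.orbit hF).rep := by
    rcases i.rep_orbit hF with h | h <;> rw [h]
    exact normalizedS_act_left_of_isEven hF i.1 (j.orbit hF).isEven_rep
  have hj : normalizedS C i.1 (j.orbit hF).rep = normalizedS C i.1 j.1 := by
    rcases j.rep_orbit hF with h | h <;> rw [h]
    exact normalizedS_act_right_of_isEven hF i.2 j.1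
  rw [quotientS, hi, hj]

theorem quotientS_evenUnit (hF : IsFermion F) (r : EvenOrbit hF) :
    quotientS hF ((evenUnit F).orbit hF) r = 2 * normalizedS C (unitLabel C) r.rep := by
  conv_lhs => rw [← r.orbit_evenRep]
  exact quotientS_orbit hF _ _

theorem quotientS_evenUnit_ne_zero (hC : IsModular C) (hF : IsFermion F) (r : EvenOrbit hF) :
    quotientS hF ((evenUnit F).orbit hF) r ≠ 0 := by
  rw [quotientS_evenUnit]
  exact mul_ne_zero two_ne_zero (normalizedS_unitLabel_ne_zero hC r.rep)

theorem quotientS_mem_unitaryGroup (hC : IsModular C) (hF : IsFermion F) :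
    quotientS hF ∈ Matrix.unitaryGroup (EvenOrbit hF) ℂ := by
  rw [Matrix.mem_unitaryGroup_iff]
  ext a b
  let g (i : Label C) : ℂ := normalizedS C a.rep i * conj (normalizedS C b.rep i)
  have hg (i : Label C) : g (act hF i) = g i := by
    simp only [g, normalizedS_act_right_of_isEven hF a.isEven_rep,
      normalizedS_act_right_of_isEven hF b.isEven_rep]
  have hcharge (i : Label C) : charge F i * g i =
      normalizedS C (act hF a.rep) i * conj (normalizedS C b.rep i) := by
    rw [normalizedS_act_left, mul_assoc]
  calc
    _ = 4 * ∑ r : EvenOrbit hF, g r.rep := by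
      rw [Matrix.mul_apply, Finset.mul_sum]
      refine Finset.sum_congr rfl fun r _ => ?_
      simp only [Matrix.star_apply, quotientS, RCLike.star_def, map_mul, map_ofNat, g]
      ring
    _ = (if a.rep = b.rep then 1 else 0) + (if act hF a.rep = b.rep then 1 else 0) := by
      simp only [four_mul_sum_evenOrbit hF hg, hcharge, g, sum_normalizedS_mul_conj hC]
    _ = _ := by
      simp only [EvenOrbit.rep_inj, EvenOrbit.act_rep_ne, if_false, add_zero, Matrix.one_apply]

theorem naiveFusion_eq_sum (hC : IsModular C) (hF : IsFermion F) (a b c : EvenOrbit hF) :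
    (naiveFusion hF a b c : ℂ) =
      ∑ r : EvenOrbit hF, quotientS hF a r * quotientS hF b r * conj (quotientS hF c r) /
        quotientS hF ((evenUnit F).orbit hF) r := by
  let g (i : Label C) : ℂ := normalizedS C a.rep i * normalizedS C b.rep i *
    conj (normalizedS C c.rep i) / normalizedS C (unitLabel C) i
  have hg (i : Label C) : g (act hF i) = g i := by
    simp only [g, normalizedS_act_right_of_isEven hF a.isEven_rep,
      normalizedS_act_right_of_isEven hF b.isEven_rep,
      normalizedS_act_right_of_isEven hF c.isEven_rep,
      normalizedS_act_right_of_isEven hF (isEven_unitLabel F)]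
  have hcharge (i : Label C) : charge F i * g i = normalizedS C a.rep i * normalizedS C b.rep i *
      conj (normalizedS C (act hF c.rep) i) / normalizedS C (unitLabel C) i := by
    rw [normalizedS_act_left, map_mul, conj_charge hF]
    ring
  calc
    _ = ∑ i, g i + ∑ i, charge F i * g i := by
      simp only [naiveFusion, Nat.cast_add, fusionCoeff_eq_sum hC, hcharge, g]
    _ = 4 * ∑ r : EvenOrbit hF, g r.rep := (four_mul_sum_evenOrbit hF hg).symm
    _ = _ := by
      rw [Finset.mul_sum]
      refine Finset.sum_congr rfl fun r _ => ?_
      have hr := normalizedS_unitLabel_ne_zero hC r.rep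
      rw [quotientS_evenUnit]
      simp only [quotientS, map_mul, map_ofNat, g]
      field_simp
      ring

end Quotient

end

end SpinModular

theorem mainTheorem8 {C : Type u} [Category.{v} C] [Abelian C] [Linear ℂ C]
    [MonoidalCategory C] [MonoidalPreadditive C] [MonoidalLinear ℂ C] [BraidedCategory C]
    [RightRigidCategory C] [SpinModular.IsFusion C] [SpinModular.Ribbon C]
    [SpinModular.Unitary C] (hC : SpinModular.IsModular C)
    (F : C) (hF : SpinModular.IsFermion F) :
    -- `[s]` and the naive fusion rules do not depend on the choice of covering labels
    (∀ i j : SpinModular.EvenLabel F,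
      SpinModular.quotientS hF (i.orbit hF) (j.orbit hF) =
        2 * SpinModular.normalizedS C i.1 j.1) ∧
    (∀ i j k : SpinModular.EvenLabel F,
      SpinModular.naiveFusion hF (i.orbit hF) (j.orbit hF) (k.orbit hF) =
        SpinModular.fusionCoeff i.1 j.1 k.1 +
          SpinModular.fusionCoeff i.1 j.1 (SpinModular.act hF k.1)) ∧
    -- `[s]` is unitary
    SpinModular.quotientS hF ∈ Matrix.unitaryGroup (SpinModular.EvenOrbit hF) ℂ ∧
    -- the Verlinde formula, whose denominators do not vanish
    (∀ r : SpinModular.EvenOrbit hF,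
      SpinModular.quotientS hF ((SpinModular.evenUnit F).orbit hF) r ≠ 0) ∧
    (∀ a b c : SpinModular.EvenOrbit hF,
      (SpinModular.naiveFusion hF a b c : ℂ) =
        ∑ r : SpinModular.EvenOrbit hF,
          SpinModular.quotientS hF a r * SpinModular.quotientS hF b r *
            (starRingEnd ℂ) (SpinModular.quotientS hF c r) /
          SpinModular.quotientS hF ((SpinModular.evenUnit F).orbit hF) r) :=
  ⟨SpinModular.quotientS_orbit hF, SpinModular.naiveFusion_orbit hF,
    SpinModular.quotientS_mem_unitaryGroup hC hF, SpinModular.quotientS_evenUnit_ne_zero hC hF,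
    SpinModular.naiveFusion_eq_sum hC hF⟩
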